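/- **Definitions.** Let $V$ be a non-empty finite set. A weight function on $V^2$ is a map $w:V\times V\to\mathbb R$ with $w(u,v)=w(v,u)\ge 0$ and $w(v,v)=0$ for all $u,v$; it is $b$-bounded if $w(u,v)\le b$ for all $u,v$. Let $G_w$ be the graph on $V$ in which $u,v$ are adjacent when $w(u,v)>0$. Put $\deg_w(u)=\sum_v w(u,v)$, $\mathrm{vol}_w(X)=\sum_{u\in X}\deg_w(u)$, and $w(V)=e_w(V)=\frac12\sum_{u,v\in V}w(u,v)$. For a partition $\mathcal A$ of $V$ let $$q_{\mathcal A}(w)=\frac1{\mathrm{vol}_w(V)}\sum_{A\in\mathcal A}\ \sum_{u,v\in A}\Big(w(u,v)-\frac{\deg_w(u)\deg_w(v)}{\mathrm{vol}_w(V)}\Big)$$ ($q_{\mathcal A}(w)=0$ if $w$ is identically $0$), let $q^*(w)=\max_{\mathcal A}q_{\mathcal A}(w)$ and $\delta_{\mathcal A}(w)=q^*(w)-q_{\mathcal A}(w)$. For $0<p\le1$, $w_p$ is the random weight function obtained by considering each edge $uv$ of $G_w$ independently, keeping $w(u,v)$ with probability $p$ and otherwise setting it to $0$. **Theorem.** There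 is an algorithm (a program of a random access machine whose unit-cost steps are arithmetic operations and comparisons on real numbers, together with additions, subtractions and comparisons of indices and indirect addressing) and a constant $K$ with the following property. The algorithm takes as input a number $\varepsilon>0$, a weight function on $V^2$ given by the list of its edges (the pairs of positive weight) with their weights, and a partition of $V$ given by vertex labels. On every such input it outputs a partition of $V$ after at most $K\,(|V|+m)$ steps, where $m$ is the number of listed edges. Moreover, for each $b>0$ and $\varepsilon>0$ there exists $c=c(b,\varepsilon)>0$ such that for every non-empty finite set $V$, every $0<p\le1$ and every $b$-bounded weight function $w$ on $V^2$ with $w(V)\,p\ge c\,|V|$, with probability at least $1-\varepsilon$ both of the following hold: (a) $|q^*(w_p)-q^*(w)|<\varepsilon$; (b) for every partition $\mathcal A$ of $V$, the algorithm, given $\varepsilon$, $w_p$ and $\mathcal A$ (and not $w$ or $p$), outputs a partition $\mathcal A'$ with $\delta_{\mathcal A'}(w)<\delta_{\mathcal A}(w_p)+\varepsilon$. -/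

import Mathlib

open Finset
open scoped unitInterval ProbabilityTheory

universe u

noncomputable section

/-! ### Weight functions and their modularity -/

/-- A weight function on `V²`: symmetric, nonnegative, and zero on the diagonal. -/
structure WeightFunction (V : Type u) where
  weight : V → V → ℝ
  symm : ∀ x y, weight x y = weight y x
  nonneg : ∀ x y, 0 ≤ weight x y
  diag : ∀ x, weight x x = 0

namespace WeightFunction

variable {V : Type u}

/-- `w` is `b`-bounded if every weight is at most `b`. -/
def Bounded (w : WeightFunction V) (b : ℝ) : Prop := ∀ x y, w.weight x y ≤ b

/-- The graph `G_w`: distinct vertices `x`, `y` are adjacent when `w(x,y) > 0`. -/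
def graph (w : WeightFunction V) : SimpleGraph V where
  Adj x y := 0 < w.weight x y
  symm := ⟨fun x y h => by rw [w.symm y x]; exact h⟩
  loopless := ⟨fun x h => by rw [w.diag x] at h; exact lt_irrefl _ h⟩

open Classical in
/-- The weight function that keeps the weights of the pairs in `S` and sets all others to `0`. -/
def keep (w : WeightFunction V) (S : Set (Sym2 V)) : WeightFunction V where
  weight x y := if s(x, y) ∈ S then w.weight x y else 0
  symm x y := by rw [Sym2.eq_swap, w.symm x y]
  nonneg x y := by split_ifs; exacts [w.nonneg x y, le_rfl]
  diag x := by rw [w.diag x, ite_self]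

/-- The law of the random set of edges of `G_w` in which each edge is kept independently with
probability `p`. If `S` is distributed in this way, then `w.keep S` is the random weight
function `w_p`. -/
def edgeLaw (w : WeightFunction V) (p : I) : MeasureTheory.Measure (Set (Sym2 V)) :=
  setBer(w.graph.edgeSet, p)

variable [Fintype V]

/-- The weighted degree `∑_y w(x,y)`. -/
def deg (w : WeightFunction V) (x : V) : ℝ := ∑ y, w.weight x y

/-- The weighted volume of a set of vertices. -/
def vol (w : WeightFunction V) (X : Finset V) : ℝ := ∑ x ∈ X, w.deg x

/-- The total weight `e_w(X) = ½ ∑_{x,y ∈ X} w(x,y)` of the edges inside `X`. -/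
def edgeWeight (w : WeightFunction V) (X : Finset V) : ℝ :=
  (1 / 2) * ∑ x ∈ X, ∑ y ∈ X, w.weight x y

variable [DecidableEq V]

/-- The modularity score of a vertex partition. For the zero weight function the volume of the
vertex set is `0`, and the value is `0` by the convention `1 / 0 = 0`. -/
def score (w : WeightFunction V) (A : Finpartition (univ : Finset V)) : ℝ :=
  (1 / w.vol univ) * ∑ X ∈ A.parts, ∑ x ∈ X, ∑ y ∈ X,
    (w.weight x y - w.deg x * w.deg y / w.vol univ)

/-- The modularity of `w`: the maximum of the scores over the (finitely many) partitions. -/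
def modularity (w : WeightFunction V) : ℝ :=
  (univ : Finset (Finpartition (univ : Finset V))).sup' ⟨⊥, mem_univ _⟩ w.score

/-- The modularity deficit of a partition. -/
def deficit (w : WeightFunction V) (A : Finpartition (univ : Finset V)) : ℝ :=
  w.modularity - w.score A

end WeightFunction

/-! ### A random access machine over the reals, with a step count

Programs are while-programs over finitely many registers and arrays, some holding natural numbers
(used as indices and counters) and some holding real numbers. Every instruction and every test
costs one step. -/

/-- The memory: registers and (indirectly addressed) arrays, over `ℕ` and over `ℝ`. -/
structure Store where
  nreg : ℕ → ℕ
  narr : ℕ → ℕ → ℕ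
  rreg : ℕ → ℝ
  rarr : ℕ → ℕ → ℝ

/-- The instructions. Natural-number registers admit constants, addition and truncated
subtraction; real registers admit natural constants and the four arithmetic operations (with
`r / 0 = 0`). Arrays are read and written at an index held in a natural-number register. -/
inductive Instr
  /-- `nreg x := k` -/
  | nconst (x k : ℕ)
  /-- `nreg x := nreg y + nreg z` -/
  | nadd (x y z : ℕ)
  /-- `nreg x := nreg y - nreg z` -/
  | nsub (x y z : ℕ)
  /-- `nreg x := narr a (nreg i)` -/
  | nload (x a i : ℕ)
  /-- `narr a (nreg i) := nreg x` -/
  | nstore (a i x : ℕ)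
  /-- `rreg x := k` -/
  | rconst (x k : ℕ)
  /-- `rreg x := rreg y + rreg z` -/
  | radd (x y z : ℕ)
  /-- `rreg x := rreg y - rreg z` -/
  | rsub (x y z : ℕ)
  /-- `rreg x := rreg y * rreg z` -/
  | rmul (x y z : ℕ)
  /-- `rreg x := rreg y / rreg z` -/
  | rdiv (x y z : ℕ)
  /-- `rreg x := rarr a (nreg i)` -/
  | rload (x a i : ℕ)
  /-- `rarr a (nreg i) := rreg x` -/
  | rstore (a i x : ℕ)

open Function in
/-- The effect of an instruction on the memory. -/
def Instr.exec : Instr → Store → Store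
  | nconst x k, s => { s with nreg := update s.nreg x k }
  | nadd x y z, s => { s with nreg := update s.nreg x (s.nreg y + s.nreg z) }
  | nsub x y z, s => { s with nreg := update s.nreg x (s.nreg y - s.nreg z) }
  | nload x a i, s => { s with nreg := update s.nreg x (s.narr a (s.nreg i)) }
  | nstore a i x, s =>
      { s with narr := update s.narr a (update (s.narr a) (s.nreg i) (s.nreg x)) }
  | rconst x k, s => { s with rreg := update s.rreg x (k : ℝ) }
  | radd x y z, s => { s with rreg := update s.rreg x (s.rreg y + s.rreg z) }
  | rsub x y z, s => { s with rreg := update s.rreg x (s.rreg y - s.rreg z) }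
  | rmul x y z, s => { s with rreg := update s.rreg x (s.rreg y * s.rreg z) }
  | rdiv x y z, s => { s with rreg := update s.rreg x (s.rreg y / s.rreg z) }
  | rload x a i, s => { s with rreg := update s.rreg x (s.rarr a (s.nreg i)) }
  | rstore a i x, s =>
      { s with rarr := update s.rarr a (update (s.rarr a) (s.nreg i) (s.rreg x)) }

/-- The tests: comparison of two natural-number registers or of two real registers. -/
inductive Test
  /-- `nreg x < nreg y` -/
  | nlt (x y : ℕ)
  /-- `rreg x ≤ rreg y` -/
  | rle (x y : ℕ)

/-- The truth value of a test. -/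
def Test.Holds : Test → Store → Prop
  | nlt x y, s => s.nreg x < s.nreg y
  | rle x y, s => s.rreg x ≤ s.rreg y

/-- While-programs. -/
inductive Program
  | skip
  | instr (i : Instr)
  | seq (P Q : Program)
  | cond (b : Test) (P Q : Program)
  | loop (b : Test) (P : Program)

/-- `P.Runs s t s'`: started in memory `s`, the program `P` halts after exactly `t` steps with
memory `s'`. -/
inductive Program.Runs : Program → Store → ℕ → Store → Prop
  | skip (s : Store) : Runs .skip s 1 s
  | instr (i : Instr) (s : Store) : Runs (.instr i) s 1 (i.exec s)
  | seq {P Q : Program} {s s₁ s₂ : Store} {t₁ t₂ : ℕ} :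
      Runs P s t₁ s₁ → Runs Q s₁ t₂ s₂ → Runs (.seq P Q) s (t₁ + t₂) s₂
  | cond_true {b : Test} {P Q : Program} {s s₁ : Store} {t : ℕ} :
      b.Holds s → Runs P s t s₁ → Runs (.cond b P Q) s (t + 1) s₁
  | cond_false {b : Test} {P Q : Program} {s s₁ : Store} {t : ℕ} :
      ¬ b.Holds s → Runs Q s t s₁ → Runs (.cond b P Q) s (t + 1) s₁
  | loop_true {b : Test} {P : Program} {s s₁ s₂ : Store} {t₁ t₂ : ℕ} :
      b.Holds s → Runs P s t₁ s₁ → Runs (.loop b P) s₁ t₂ s₂ →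
        Runs (.loop b P) s (t₁ + t₂ + 1) s₂
  | loop_false {b : Test} {P : Program} {s : Store} :
      ¬ b.Holds s → Runs (.loop b P) s 1 s

/-- The semantics is deterministic: final memory and number of steps are determined by the
program and the initial memory. -/
theorem Program.Runs.deterministic {P : Program} {s s₁ : Store} {t₁ : ℕ}
    (h₁ : P.Runs s t₁ s₁) : ∀ {t₂ : ℕ} {s₂ : Store}, P.Runs s t₂ s₂ → t₁ = t₂ ∧ s₁ = s₂ := by
  induction h₁ with
  | skip s => intro _ _ h; cases h; exact ⟨rfl, rfl⟩
  | instr i s => intro _ _ h; cases h; exact ⟨rfl, rfl⟩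
  | seq _ _ ih ih' =>
    intro _ _ h
    cases h with
    | seq h h' =>
      obtain ⟨rfl, rfl⟩ := ih h
      obtain ⟨rfl, rfl⟩ := ih' h'
      exact ⟨rfl, rfl⟩
  | cond_true hb _ ih =>
    intro _ _ h
    cases h with
    | cond_true _ h => obtain ⟨rfl, rfl⟩ := ih h; exact ⟨rfl, rfl⟩
    | cond_false hb' _ => exact absurd hb hb'
  | cond_false hb _ ih =>
    intro _ _ h
    cases h with
    | cond_true hb' _ => exact absurd hb' hb
    | cond_false _ h => obtain ⟨rfl, rfl⟩ := ih h; exact ⟨rfl, rfl⟩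
  | loop_true hb _ _ ih ih' =>
    intro _ _ h
    cases h with
    | loop_true _ h h' =>
      obtain ⟨rfl, rfl⟩ := ih h
      obtain ⟨rfl, rfl⟩ := ih' h'
      exact ⟨rfl, rfl⟩
    | loop_false hb' => exact absurd hb hb'
  | loop_false hb =>
    intro _ _ h
    cases h with
    | loop_true hb' _ _ => exact absurd hb' hb
    | loop_false _ => exact ⟨rfl, rfl⟩

/-! ### Weighted graphs and partitions as inputs and outputs -/

section Encoding

variable {V : Type u} [Fintype V] [DecidableEq V]

/-- A labelling of the vertices by `0, …, |V| - 1` describes a partition if two vertices have the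
same label exactly when they lie in the same part. -/
def Describes (label : V → Fin (Fintype.card V)) (A : Finpartition (univ : Finset V)) : Prop :=
  ∀ x y, label x = label y ↔ A.part x = A.part y

/-- An input instance: a numbering of the vertices, a list containing every edge of `G_w` exactly
once (in some order, each with some orientation), and a labelling of the vertices describing the
partition `A`. -/
structure Encoding (w : WeightFunction V) (A : Finpartition (univ : Finset V)) where
  enum : V ≃ Fin (Fintype.card V)
  edges : List (V × V)
  edges_nodup : (edges.map fun q => s(q.1, q.2)).Nodup
  mem_edges : ∀ e : Sym2 V, e ∈ (edges.map fun q => s(q.1, q.2)) ↔ e ∈ w.graph.edgeSet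
  label : V → Fin (Fintype.card V)
  describes : Describes label A

namespace Encoding

variable {w : WeightFunction V} {A : Finpartition (univ : Finset V)}

/-- The size of an instance: number of vertices plus number of edges. -/
def size (E : Encoding w A) : ℕ := Fintype.card V + E.edges.length

/-- The initial memory for an instance and a parameter `ε`. The natural-number registers `0`, `1`
hold the numbers of vertices and edges, the real register `0` holds `ε`. The `i`-th listed edge
has its ends in position `i` of the natural-number arrays `0`, `1` and its weight in position `i`
of the real array `0`. The label of the `i`-th vertex is in position `i` of the natural-number
array `2`. Everything else is `0`. -/
def store (E : Encoding w A) (ε : ℝ) : Store where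
  nreg
    | 0 => Fintype.card V
    | 1 => E.edges.length
    | _ => 0
  narr
    | 0 => fun i => (E.edges[i]?).elim 0 fun q => (E.enum q.1 : ℕ)
    | 1 => fun i => (E.edges[i]?).elim 0 fun q => (E.enum q.2 : ℕ)
    | 2 => fun i => if h : i < Fintype.card V then (E.label (E.enum.symm ⟨i, h⟩) : ℕ) else 0
    | _ => fun _ => 0
  rreg
    | 0 => ε
    | _ => 0
  rarr
    | 0 => fun i => (E.edges[i]?).elim 0 fun q => w.weight q.1 q.2
    | _ => fun _ => 0

end Encoding

/-- On the instance `E` with parameter `ε`, the program `P` halts after at most `T` steps, and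
then the natural-number array `3` holds a labelling that describes the partition `A'`. -/
def Program.Outputs (P : Program) {w : WeightFunction V} {A : Finpartition (univ : Finset V)}
    (E : Encoding w A) (ε : ℝ) (T : ℕ) (A' : Finpartition (univ : Finset V)) : Prop :=
  ∃ (t : ℕ) (s : Store) (label : V → Fin (Fintype.card V)),
    P.Runs (E.store ε) t s ∧ t ≤ T ∧
      (∀ x, s.narr 3 (E.enum x) = label x) ∧ Describes label A'

end Encoding

end

/-!
By a Chernoff bound and a union bound over the `2 ^ |V|` sets of vertices, with probability close
to `1` the weights of the edges inside all vertex sets are simultaneously close to `p` times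
their original values, with an error that is small relative to the total weight. The score of a
partition is a sum over its parts of terms determined by such weights, so the scores of `w` and
`w_p` are close on all partitions into boundedly many parts. These suffice: packing the parts in
order into bins, where a bin is closed once its volume reaches the fraction `η` of the total,
gives at most `1 / η + 1` bins and loses at most `2 η` of the score, because before a part is
added to a bin the volume of the bin is at most that fraction. This packing takes linear time.
-/

noncomputable section

/-! ### Sums of centred Bernoulli variables -/

section SetBernoulli

open MeasureTheory ProbabilityTheory

theorem exp_centered_bernoulli_le {p x : ℝ} (hp : 0 ≤ p) (hx : |x| ≤ 1) :
    p * Real.exp ((1 - p) * x) + (1 - p) * Real.exp (-(p * x)) ≤ Real.exp (p * x ^ 2) := by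
  have hexp : Real.exp x ≤ 1 + x + x ^ 2 := by
    linarith [abs_le.1 (Real.abs_exp_sub_one_sub_id_le hx)]
  calc p * Real.exp ((1 - p) * x) + (1 - p) * Real.exp (-(p * x))
      = (p * Real.exp x + (1 - p)) * Real.exp (-(p * x)) := by
        rw [show (1 - p) * x = x + -(p * x) by ring, Real.exp_add]
        ring
    _ ≤ Real.exp (p * (x + x ^ 2)) * Real.exp (-(p * x)) := by
        gcongr
        linarith [mul_le_mul_of_nonneg_left hexp hp, Real.add_one_le_exp (p * (x + x ^ 2))]
    _ = Real.exp (p * x ^ 2) := by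
        rw [← Real.exp_add]
        ring_nf

variable {ι : Type*} (u : Set ι) (p : I)

theorem map_mem_setBernoulli (i : ι) :
    setBer(u, p).map (fun S => i ∈ S) =
      unitInterval.toNNReal p • Measure.dirac (i ∈ u) +
        unitInterval.toNNReal (unitInterval.symm p) • Measure.dirac False := by
  rw [setBernoulli_eq_map, Measure.map_map (by fun_prop) (by fun_prop)]
  exact Measure.infinitePi_map_eval _ i

theorem iIndepFun_mem_setBernoulli : iIndepFun (fun i (S : Set ι) => i ∈ S) setBer(u, p) := by
  rw [iIndepFun_iff_map_fun_eq_infinitePi_map measurable_set_mem]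
  simp_rw [map_mem_setBernoulli]
  rw [setBernoulli_eq_map, Measure.map_map (by fun_prop) (by fun_prop)]
  exact Measure.map_id

theorem mgf_centered_setBernoulli_le {i : ι} (hi : i ∈ u) {a t : ℝ} (ha : |t * a| ≤ 1) :
    mgf (fun S : Set ι => (S.indicator 1 i - (p : ℝ)) * a) setBer(u, p) t ≤
      Real.exp (p * (t * a) ^ 2) := by
  classical
  let f : Prop → ℝ := fun q => ((if q then 1 else 0) - (p : ℝ)) * a
  calc mgf (fun S : Set ι => (S.indicator 1 i - (p : ℝ)) * a) setBer(u, p) t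
      = mgf f (setBer(u, p).map (fun S => i ∈ S)) t := by
        rw [mgf_map (measurable_set_mem i).aemeasurable (by fun_prop)]
        rfl
    _ = p * Real.exp ((1 - p) * (t * a)) + (1 - p) * Real.exp (-(p * (t * a))) := by
        rw [map_mem_setBernoulli, mgf, integral_add_measure .of_finite .of_finite,
          integral_smul_nnreal_measure, integral_smul_nnreal_measure, integral_dirac,
          integral_dirac]
        simp only [f, hi, if_true, if_false, NNReal.smul_def, unitInterval.coe_toNNReal,
          smul_eq_mul, unitInterval.coe_symm_eq]
        ring_nf
    _ ≤ Real.exp (p * (t * a) ^ 2) := exp_centered_bernoulli_le p.2.1 ha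

theorem iIndepFun_centered_setBernoulli (a : ι → ℝ) :
    iIndepFun (fun i (S : Set ι) => (S.indicator 1 i - (p : ℝ)) * a i) setBer(u, p) := by
  classical
  exact (iIndepFun_mem_setBernoulli u p).comp
    (fun i q => ((if q then 1 else 0) - (p : ℝ)) * a i) fun _ => .of_discrete

theorem measurable_centered_indicator (a : ℝ) (i : ι) :
    Measurable fun S : Set ι => (S.indicator 1 i - (p : ℝ)) * a := by
  classical
  have h : Measurable fun q : Prop => ((if q then 1 else 0) - (p : ℝ)) * a := .of_discrete
  exact h.comp (measurable_set_mem i)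

theorem integrable_exp_centered_setBernoulli (s : Finset ι) (a : ι → ℝ) (t : ℝ) :
    Integrable (fun S : Set ι => Real.exp (t * ∑ i ∈ s, (S.indicator 1 i - (p : ℝ)) * a i))
      setBer(u, p) := by
  classical
  have hexp (i : ι) : Integrable
      (fun S : Set ι => Real.exp (t * ((S.indicator 1 i - (p : ℝ)) * a i))) setBer(u, p) := by
    have h : Integrable (fun q : Prop => Real.exp (t * (((if q then 1 else 0) - (p : ℝ)) * a i)))
        (setBer(u, p).map fun S => i ∈ S) := .of_finite
    exact h.comp_measurable (measurable_set_mem i)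
  simpa only [Finset.sum_apply] using
    (iIndepFun_centered_setBernoulli u p a).integrable_exp_mul_sum
      (fun i => measurable_centered_indicator p (a i) i) (s := s) fun i _ => hexp i

variable {u} {s : Finset ι} {a : ι → ℝ} {t : ℝ}

theorem mgf_sum_centered_setBernoulli_le (hs : ∀ i ∈ s, i ∈ u) (ha : ∀ i ∈ s, |t * a i| ≤ 1) :
    mgf (fun S : Set ι => ∑ i ∈ s, (S.indicator 1 i - (p : ℝ)) * a i) setBer(u, p) t ≤
      Real.exp (p * t ^ 2 * ∑ i ∈ s, a i ^ 2) := by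
  have hsum : (fun S : Set ι => ∑ i ∈ s, (S.indicator 1 i - (p : ℝ)) * a i) =
      ∑ i ∈ s, fun S : Set ι => (S.indicator 1 i - (p : ℝ)) * a i := by
    ext S
    rw [Finset.sum_apply]
  rw [hsum, (iIndepFun_centered_setBernoulli u p a).mgf_sum
    (fun i => measurable_centered_indicator p (a i) i), Finset.mul_sum, Real.exp_sum]
  refine Finset.prod_le_prod (fun _ _ => mgf_nonneg) fun i hi => ?_
  rw [mul_assoc, ← mul_pow]
  exact mgf_centered_setBernoulli_le u p (hs i hi) (ha i hi)

theorem setBernoulli_real_le_abs_sum_le (hs : ∀ i ∈ s, i ∈ u) (ht : 0 ≤ t)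
    (ha : ∀ i ∈ s, |t * a i| ≤ 1) (r : ℝ) :
    setBer(u, p).real {S | r ≤ |∑ i ∈ s, (S.indicator 1 i - (p : ℝ)) * a i|} ≤
      2 * Real.exp (p * t ^ 2 * ∑ i ∈ s, a i ^ 2 - t * r) := by
  set X : Set ι → ℝ := fun S => ∑ i ∈ s, (S.indicator 1 i - (p : ℝ)) * a i
  have hupper : setBer(u, p).real {S | r ≤ X S} ≤
      Real.exp (-t * r) * mgf X setBer(u, p) t :=
    measure_ge_le_exp_mul_mgf r ht (integrable_exp_centered_setBernoulli u p s a t)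
  have hlower : setBer(u, p).real {S | X S ≤ -r} ≤
      Real.exp (-(-t) * -r) * mgf X setBer(u, p) (-t) :=
    measure_le_le_exp_mul_mgf (-r) (neg_nonpos.2 ht)
      (integrable_exp_centered_setBernoulli u p s a (-t))
  have hmgf := mgf_sum_centered_setBernoulli_le p hs ha
  have hmgf_neg := mgf_sum_centered_setBernoulli_le (t := -t) p hs (by simpa using ha)
  rw [neg_sq] at hmgf_neg
  calc setBer(u, p).real {S | r ≤ |X S|}
      ≤ setBer(u, p).real ({S | r ≤ X S} ∪ {S | X S ≤ -r}) :=
        measureReal_mono fun S (hS : r ≤ |X S|) => (le_abs.1 hS).imp id le_neg_of_le_neg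
    _ ≤ setBer(u, p).real {S | r ≤ X S} + setBer(u, p).real {S | X S ≤ -r} :=
        measureReal_union_le _ _
    _ ≤ Real.exp (-t * r) * Real.exp (p * t ^ 2 * ∑ i ∈ s, a i ^ 2) +
          Real.exp (-(-t) * -r) * Real.exp (p * t ^ 2 * ∑ i ∈ s, a i ^ 2) := by
        gcongr
        · exact hupper.trans (by gcongr)
        · exact hlower.trans (by gcongr)
    _ = 2 * Real.exp (p * t ^ 2 * ∑ i ∈ s, a i ^ 2 - t * r) := by
        simp only [← Real.exp_add]
        ring_nf

end SetBernoulli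

/-! ### Concentration of edge weights -/

theorem two_pow_mul_exp_le {n : ℕ} (hn : 0 < n) {ε x : ℝ} (hε : 0 < ε)
    (hx : (2 + 1 / ε) * n ≤ x) : 2 ^ n * (2 * Real.exp (-x)) ≤ ε := by
  have hn1 : (1 : ℝ) ≤ n := by exact_mod_cast hn
  have htwo : (2 : ℝ) ≤ Real.exp 1 := by linarith [Real.add_one_le_exp 1]
  calc (2 : ℝ) ^ n * (2 * Real.exp (-x))
      ≤ Real.exp 1 ^ n * (Real.exp 1 * Real.exp (-x)) := by gcongr
    _ = Real.exp (n + (1 + -x)) := by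
      rw [← Real.exp_nat_mul, mul_one, Real.exp_add, Real.exp_add]
    _ ≤ Real.exp (-(1 / ε)) := by
      rw [Real.exp_le_exp]
      linarith [le_mul_of_one_le_right (one_div_pos.2 hε).le hn1]
    _ ≤ ε := by
      rw [Real.exp_neg, inv_le_comm₀ (Real.exp_pos _) hε, ← one_div]
      linarith [Real.add_one_le_exp (1 / ε)]

theorem sq_div_six_mul_one_add_sq_lt_one {η : ℝ} (hη : 0 ≤ η) : η ^ 2 / (6 * (1 + η) ^ 2) < 1 := by
  rw [div_lt_one (by positivity)]
  nlinarith

theorem sum_sum_eq_sum_sym2 {α M : Type*} [AddCommMonoid M] (s : Finset α) (F : α → α → M)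
    (hF : ∀ a, F a a = 0) :
    ∑ x ∈ s, ∑ y ∈ s, F x y =
      ∑ e ∈ s.sym2, Sym2.lift ⟨fun x y => F x y + F y x, fun _ _ => add_comm _ _⟩ e := by
  induction s using Finset.cons_induction with
  | empty => simp only [Finset.sum_empty, Finset.sym2_empty]
  | cons a s ha ih =>
    simp only [Finset.sum_cons, Finset.sum_add_distrib, Finset.sym2_cons, Finset.sum_disjUnion,
      Finset.sum_map, Sym2.mkEmbedding_apply, Sym2.lift_mk, hF, zero_add, ← ih]
    abel

namespace WeightFunction

variable {V : Type u} (w : WeightFunction V)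

/-- The weight as a function of unordered pairs, so that independent edges can be summed over. -/
def symWeight : Sym2 V → ℝ := Sym2.lift ⟨w.weight, w.symm⟩

theorem symWeight_nonneg (e : Sym2 V) : 0 ≤ w.symWeight e := by
  induction e with
  | _ x y => exact w.nonneg x y

theorem symWeight_le {b : ℝ} (hw : w.Bounded b) (e : Sym2 V) : w.symWeight e ≤ b := by
  induction e with
  | _ x y => exact hw x y

theorem symWeight_eq_zero {e : Sym2 V} (he : e ∉ w.graph.edgeSet) : w.symWeight e = 0 := by
  induction e with
  | _ x y => exact le_antisymm (not_lt.1 he) (w.nonneg x y)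

theorem symWeight_keep (S : Set (Sym2 V)) (e : Sym2 V) :
    (w.keep S).symWeight e = S.indicator 1 e * w.symWeight e := by
  classical
  induction e with
  | _ x y =>
    change (if s(x, y) ∈ S then w.weight x y else 0) = S.indicator 1 s(x, y) * w.weight x y
    rw [Set.indicator_apply, Pi.one_apply, ite_mul, one_mul, zero_mul]

theorem edgeWeight_eq_sum_sym2 (X : Finset V) : w.edgeWeight X = ∑ e ∈ X.sym2, w.symWeight e := by
  rw [edgeWeight, sum_sum_eq_sum_sym2 X w.weight w.diag, Finset.mul_sum]
  refine Finset.sum_congr rfl fun e _ => ?_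
  induction e with
  | _ x y =>
    change 1 / 2 * (w.weight x y + w.weight y x) = w.weight x y
    rw [w.symm y x]
    ring

theorem edgeWeight_nonneg (X : Finset V) : 0 ≤ w.edgeWeight X := by
  rw [edgeWeight_eq_sum_sym2]
  exact Finset.sum_nonneg fun e _ => w.symWeight_nonneg e

theorem edgeWeight_mono {X Y : Finset V} (h : X ⊆ Y) : w.edgeWeight X ≤ w.edgeWeight Y := by
  rw [edgeWeight_eq_sum_sym2, edgeWeight_eq_sum_sym2]
  exact Finset.sum_le_sum_of_subset_of_nonneg (Finset.sym2_mono h) fun e _ _ =>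
    w.symWeight_nonneg e

theorem edgeWeight_keep_sub (S : Set (Sym2 V)) (p : ℝ) (X : Finset V) :
    (w.keep S).edgeWeight X - p * w.edgeWeight X =
      ∑ e ∈ X.sym2, (S.indicator 1 e - p) * w.symWeight e := by
  simp only [edgeWeight_eq_sum_sym2, symWeight_keep, Finset.mul_sum, sub_mul,
    Finset.sum_sub_distrib]

theorem sum_sq_symWeight_le {b : ℝ} (hw : w.Bounded b) (X : Finset V) :
    ∑ e ∈ X.sym2, w.symWeight e ^ 2 ≤ b * w.edgeWeight X := by
  rw [edgeWeight_eq_sum_sym2, Finset.mul_sum]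
  gcongr with e
  rw [sq]
  exact mul_le_mul_of_nonneg_right (w.symWeight_le hw e) (w.symWeight_nonneg e)

section Concentration

open MeasureTheory ProbabilityTheory

instance isProbabilityMeasure_edgeLaw (p : I) : IsProbabilityMeasure (w.edgeLaw p) := by
  unfold edgeLaw
  infer_instance

variable {b δ : ℝ} {w}

theorem edgeLaw_real_le_abs_sub_le [Fintype V] (hw : w.Bounded b) (p : I) (hb : 0 < b)
    (hδ₀ : 0 ≤ δ) (hδ : δ ≤ 2) (X : Finset V) :
    (w.edgeLaw p).real
        {S | δ * (p * w.edgeWeight univ) ≤ |(w.keep S).edgeWeight X - p * w.edgeWeight X|} ≤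
      2 * Real.exp (-(δ ^ 2 / (4 * b) * (w.edgeWeight univ * p))) := by
  classical
  set t := δ / (2 * b)
  have ht : 0 ≤ t := by positivity
  have ha : ∀ e, |t * w.symWeight e| ≤ 1 := fun e =>
    calc |t * w.symWeight e| = t * w.symWeight e :=
          abs_of_nonneg (mul_nonneg ht (w.symWeight_nonneg e))
      _ ≤ t * b := by gcongr; exact w.symWeight_le hw e
      _ = δ / 2 := by simp only [t]; field_simp
      _ ≤ 1 := by linarith
  have hsum (S : Set (Sym2 V)) : (w.keep S).edgeWeight X - p * w.edgeWeight X =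
      ∑ e ∈ X.sym2 with e ∈ w.graph.edgeSet, (S.indicator 1 e - (p : ℝ)) * w.symWeight e := by
    rw [edgeWeight_keep_sub, Finset.sum_filter_of_ne fun e _ he => ?_]
    exact not_imp_comm.1 w.symWeight_eq_zero (right_ne_zero_of_mul he)
  have hsq : ∑ e ∈ X.sym2 with e ∈ w.graph.edgeSet, w.symWeight e ^ 2 ≤
      b * w.edgeWeight univ :=
    calc _ ≤ ∑ e ∈ X.sym2, w.symWeight e ^ 2 :=
          Finset.sum_le_sum_of_subset_of_nonneg (filter_subset _ _) fun _ _ _ => sq_nonneg _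
      _ ≤ b * w.edgeWeight X := w.sum_sq_symWeight_le hw X
      _ ≤ b * w.edgeWeight univ := by gcongr; exact w.edgeWeight_mono (subset_univ X)
  simp_rw [hsum]
  refine (setBernoulli_real_le_abs_sum_le p (fun e he => (mem_filter.1 he).2) ht
    (fun e _ => ha e) _).trans ?_
  gcongr
  calc p * t ^ 2 * ∑ e ∈ X.sym2 with e ∈ w.graph.edgeSet, w.symWeight e ^ 2 -
        t * (δ * (p * w.edgeWeight univ))
      ≤ p * t ^ 2 * (b * w.edgeWeight univ) - t * (δ * (p * w.edgeWeight univ)) := by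
        have := p.2.1
        gcongr
    _ = -(δ ^ 2 / (4 * b) * (w.edgeWeight univ * p)) := by
        simp only [t]
        field_simp
        ring

variable [Fintype V]

/-- The weights inside all sets of vertices are those of `q • w`, up to `δ` times the total
weight of `q • w`. -/
def ApproxScaled (w' : WeightFunction V) (q : ℝ) (w : WeightFunction V) (δ : ℝ) : Prop :=
  ∀ X : Finset V, |w'.edgeWeight X - q * w.edgeWeight X| ≤ δ * (q * w.edgeWeight univ)

theorem edgeLaw_real_approxScaled_ge (hw : w.Bounded b) (p : I) (hb : 0 < b)
    (hδ₀ : 0 ≤ δ) (hδ : δ ≤ 2) :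
    1 - 2 ^ Fintype.card V * (2 * Real.exp (-(δ ^ 2 / (4 * b) * (w.edgeWeight univ * p)))) ≤
      (w.edgeLaw p).real {S | (w.keep S).ApproxScaled p w δ} := by
  set bad : Finset V → Set (Set (Sym2 V)) := fun X =>
    {S | δ * (p * w.edgeWeight univ) ≤ |(w.keep S).edgeWeight X - p * w.edgeWeight X|}
  have hsub : {S | (w.keep S).ApproxScaled p w δ}ᶜ ⊆ ⋃ X ∈ (univ : Finset (Finset V)), bad X := by
    intro S hS
    obtain ⟨X, hX⟩ := not_forall.1 hS
    exact Set.mem_biUnion (mem_univ X) (not_le.1 hX).le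
  rw [← sub_le_comm, ← probReal_compl_eq_one_sub (Set.toFinite _).measurableSet]
  calc (w.edgeLaw p).real {S | (w.keep S).ApproxScaled p w δ}ᶜ
      ≤ ∑ X, (w.edgeLaw p).real (bad X) :=
        (measureReal_mono hsub (measure_ne_top _ _)).trans (measureReal_biUnion_finset_le _ _)
    _ ≤ ∑ _X : Finset V, 2 * Real.exp (-(δ ^ 2 / (4 * b) * (w.edgeWeight univ * p))) :=
        Finset.sum_le_sum fun X _ => edgeLaw_real_le_abs_sub_le hw p hb hδ₀ hδ X
    _ = 2 ^ Fintype.card V * (2 * Real.exp (-(δ ^ 2 / (4 * b) * (w.edgeWeight univ * p)))) := by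
        rw [Finset.sum_const, Finset.card_univ, Fintype.card_finset, nsmul_eq_mul]
        push_cast
        rfl

theorem one_sub_le_edgeLaw_real_approxScaled [Nonempty V] (hw : w.Bounded b) (p : I) (hb : 0 < b)
    (hδ₀ : 0 < δ) (hδ : δ ≤ 2) {ε : ℝ} (hε : 0 < ε)
    (hp : 4 * b / δ ^ 2 * (2 + 1 / ε) * Fintype.card V ≤ w.edgeWeight univ * p) :
    1 - ε ≤ (w.edgeLaw p).real {S | (w.keep S).ApproxScaled p w δ} := by
  have hlarge : (2 + 1 / ε) * Fintype.card V ≤ δ ^ 2 / (4 * b) * (w.edgeWeight univ * p) :=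
    calc (2 + 1 / ε) * Fintype.card V
        = δ ^ 2 / (4 * b) * (4 * b / δ ^ 2 * (2 + 1 / ε) * Fintype.card V) := by field_simp
      _ ≤ δ ^ 2 / (4 * b) * (w.edgeWeight univ * p) := by gcongr
  linarith [two_pow_mul_exp_le Fintype.card_pos hε hlarge,
    edgeLaw_real_approxScaled_ge hw p hb hδ₀.le hδ]

end Concentration

end WeightFunction

/-! ### Scores of approximately scaled weight functions -/

section Labelling

variable {V : Type u} [Fintype V] [DecidableEq V]

/-- The labelling `f` describes the partition `A`: two vertices have the same label exactly when
they lie in the same part. This is `Describes` for arbitrary labels. -/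
def IsLabelling {L : Type*} (f : V → L) (A : Finpartition (univ : Finset V)) : Prop :=
  ∀ x y, f x = f y ↔ A.part x = A.part y

open Classical in
/-- The partition into the fibres of a labelling. -/
def labelPartition {L : Type*} (f : V → L) : Finpartition (univ : Finset V) :=
  Finpartition.ofSetoid (Setoid.ker f)

theorem isLabelling_labelPartition {L : Type*} (f : V → L) : IsLabelling f (labelPartition f) := by
  classical
  intro x y
  rw [eq_comm, ← Setoid.ker_def, ← Finpartition.mem_part_ofSetoid_iff_rel,
    Finpartition.mem_part_iff_part_eq_part _ (mem_univ x) (mem_univ y)]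
  rfl

theorem exists_isLabelling (A : Finpartition (univ : Finset V)) : ∃ f : V → ℕ, IsLabelling f A :=
  ⟨fun x => Fintype.equivFin (Finset V) (A.part x), fun _ _ => by
    rw [Fin.val_inj, EmbeddingLike.apply_eq_iff_eq]⟩

namespace IsLabelling

variable {L : Type*} [DecidableEq L] {f : V → L} {A : Finpartition (univ : Finset V)}

theorem part_eq (hf : IsLabelling f A) (x : V) : A.part x = ({y | f y = f x} : Finset V) := by
  ext y
  rw [mem_filter_univ, hf, A.mem_part_iff_part_eq_part (mem_univ y) (mem_univ x)]

theorem card_parts_le (hf : IsLabelling f A) : #A.parts ≤ #(univ.image f) := by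
  have hparts : A.parts ⊆ (univ.image f).image fun l => ({y | f y = l} : Finset V) := by
    intro X hX
    obtain ⟨x, hx⟩ := A.nonempty_of_mem_parts hX
    rw [← A.part_eq_of_mem hX hx, hf.part_eq x]
    exact mem_image_of_mem _ (mem_image_of_mem f (mem_univ x))
  exact (card_le_card hparts).trans card_image_le

end IsLabelling

end Labelling

namespace WeightFunction

section Score

variable {V : Type u} [Fintype V] (w : WeightFunction V)

theorem deg_nonneg (x : V) : 0 ≤ w.deg x := Finset.sum_nonneg fun y _ => w.nonneg x y

theorem vol_nonneg (X : Finset V) : 0 ≤ w.vol X := Finset.sum_nonneg fun x _ => w.deg_nonneg x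

theorem vol_mono {X Y : Finset V} (h : X ⊆ Y) : w.vol X ≤ w.vol Y :=
  Finset.sum_le_sum_of_subset_of_nonneg h fun x _ _ => w.deg_nonneg x

theorem vol_univ : w.vol univ = 2 * w.edgeWeight univ := by
  rw [edgeWeight, ← mul_assoc, mul_one_div_cancel two_ne_zero, one_mul]
  rfl

theorem vol_univ_pos : 0 < w.vol univ ↔ 0 < w.edgeWeight univ := by
  rw [vol_univ, mul_pos_iff_of_pos_left two_pos]

theorem vol_div_vol_univ_nonneg (X : Finset V) : 0 ≤ w.vol X / w.vol univ :=
  div_nonneg (w.vol_nonneg X) (w.vol_nonneg univ)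

theorem vol_div_vol_univ_le_one (X : Finset V) : w.vol X / w.vol univ ≤ 1 :=
  div_le_one_of_le₀ (w.vol_mono (subset_univ X)) (w.vol_nonneg univ)

variable [DecidableEq V]

theorem vol_eq_edgeWeight (X : Finset V) :
    w.vol X = w.edgeWeight univ + w.edgeWeight X - w.edgeWeight Xᶜ := by
  have hcut : ∑ x ∈ Xᶜ, ∑ y ∈ X, w.weight x y = ∑ x ∈ X, ∑ y ∈ Xᶜ, w.weight x y := by
    rw [Finset.sum_comm]
    simp only [w.symm]
  simp_rw [vol, deg, edgeWeight, ← Finset.sum_add_sum_compl X, Finset.sum_add_distrib, hcut]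
  ring

theorem score_eq_sum_parts (A : Finpartition (univ : Finset V)) :
    w.score A = ∑ X ∈ A.parts,
      (w.edgeWeight X / w.edgeWeight univ - (w.vol X / w.vol univ) ^ 2) := by
  rw [score, Finset.mul_sum]
  refine Finset.sum_congr rfl fun X _ => ?_
  have hdeg : ∑ x ∈ X, ∑ y ∈ X, w.deg x * w.deg y / w.vol univ = w.vol X ^ 2 / w.vol univ := by
    simp_rw [← Finset.sum_div, ← Finset.mul_sum, ← Finset.sum_mul, sq]
    rfl
  have hweight : ∑ x ∈ X, ∑ y ∈ X, w.weight x y = 2 * w.edgeWeight X := by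
    rw [edgeWeight, ← mul_assoc, mul_one_div_cancel two_ne_zero, one_mul]
  simp_rw [Finset.sum_sub_distrib]
  rw [hdeg, hweight, mul_sub, one_div_mul_eq_div, one_div_mul_eq_div, div_div, ← sq, ← div_pow]
  rw [w.vol_univ, mul_div_mul_left _ _ two_ne_zero]

theorem score_eq_sum_part (A : Finpartition (univ : Finset V)) :
    w.score A = 1 / w.vol univ *
      ∑ x, ∑ y ∈ A.part x, (w.weight x y - w.deg x * w.deg y / w.vol univ) := by
  rw [score]
  congr 1
  have hunion := Finset.sum_biUnion A.disjoint
    (f := fun x => ∑ y ∈ A.part x, (w.weight x y - w.deg x * w.deg y / w.vol univ))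
  rw [A.biUnion_parts] at hunion
  rw [hunion]
  refine Finset.sum_congr rfl fun X hX => Finset.sum_congr rfl fun x hx => ?_
  rw [A.part_eq_of_mem hX hx]

theorem score_sub_le_of_part_subset {A B : Finpartition (univ : Finset V)}
    (h : ∀ x, A.part x ⊆ B.part x) :
    w.score A - (∑ x, ∑ y ∈ B.part x \ A.part x, w.deg x * w.deg y) / w.vol univ ^ 2 ≤
      w.score B := by
  have hv := w.vol_nonneg univ
  have hsdiff (x : V) : ∑ y ∈ A.part x, (w.weight x y - w.deg x * w.deg y / w.vol univ) -
      (∑ y ∈ B.part x \ A.part x, w.deg x * w.deg y) / w.vol univ ≤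
        ∑ y ∈ B.part x, (w.weight x y - w.deg x * w.deg y / w.vol univ) := by
    rw [← Finset.sum_sdiff (h x), Finset.sum_sub_distrib (s := B.part x \ A.part x),
      ← Finset.sum_div]
    linarith [Finset.sum_nonneg fun y (_ : y ∈ B.part x \ A.part x) => w.nonneg x y]
  calc w.score A - (∑ x, ∑ y ∈ B.part x \ A.part x, w.deg x * w.deg y) / w.vol univ ^ 2
      = 1 / w.vol univ *
          ∑ x, (∑ y ∈ A.part x, (w.weight x y - w.deg x * w.deg y / w.vol univ) -
            (∑ y ∈ B.part x \ A.part x, w.deg x * w.deg y) / w.vol univ) := by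
        rw [score_eq_sum_part, Finset.sum_sub_distrib, ← Finset.sum_div, mul_sub,
          one_div_mul_eq_div (w.vol univ) (_ / _), div_div, ← sq]
    _ ≤ 1 / w.vol univ *
          ∑ x, ∑ y ∈ B.part x, (w.weight x y - w.deg x * w.deg y / w.vol univ) := by
        gcongr with x
        exact hsdiff x
    _ = w.score B := (w.score_eq_sum_part B).symm

end Score

namespace ApproxScaled

variable {V : Type u} [Fintype V] {w w' : WeightFunction V} {q δ : ℝ}

theorem edgeWeight_univ_pos (h : w'.ApproxScaled q w δ) (hw : 0 < q * w.edgeWeight univ)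
    (hδ : δ < 1) : 0 < w'.edgeWeight univ := by
  linarith [(abs_le.1 (h univ)).1, mul_lt_mul_of_pos_right hδ hw]

theorem abs_edgeWeight_div_sub_le (h : w'.ApproxScaled q w δ) (hw : 0 < q * w.edgeWeight univ)
    (hδ : δ < 1) (X : Finset V) :
    |w'.edgeWeight X / w'.edgeWeight univ - w.edgeWeight X / w.edgeWeight univ| ≤ 2 * δ := by
  have hw' := h.edgeWeight_univ_pos hw hδ
  obtain ⟨hq, hw₀⟩ := mul_ne_zero_iff.1 hw.ne'
  have hratio : |w'.edgeWeight X / w'.edgeWeight univ| ≤ 1 := by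
    rw [abs_of_nonneg (div_nonneg (w'.edgeWeight_nonneg X) hw'.le)]
    exact div_le_one_of_le₀ (w'.edgeWeight_mono (subset_univ X)) hw'.le
  have hdev (Y : Finset V) :
      |(w'.edgeWeight Y - q * w.edgeWeight Y) / (q * w.edgeWeight univ)| ≤ δ := by
    rw [abs_div, abs_of_pos hw, div_le_iff₀ hw]
    exact h Y
  calc |w'.edgeWeight X / w'.edgeWeight univ - w.edgeWeight X / w.edgeWeight univ|
      = |(w'.edgeWeight X - q * w.edgeWeight X) / (q * w.edgeWeight univ) -
          w'.edgeWeight X / w'.edgeWeight univ *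
            ((w'.edgeWeight univ - q * w.edgeWeight univ) / (q * w.edgeWeight univ))| := by
        congr 1
        field_simp
        ring
    _ ≤ δ + 1 * δ := by
        refine (abs_sub _ _).trans (add_le_add (hdev X) ?_)
        rw [abs_mul]
        exact mul_le_mul hratio (hdev univ) (abs_nonneg _) zero_le_one
    _ = 2 * δ := by ring

theorem abs_vol_div_sub_le (h : w'.ApproxScaled q w δ) (hw : 0 < q * w.edgeWeight univ)
    (hδ : δ < 1) (X : Finset V) : |w'.vol X / w'.vol univ - w.vol X / w.vol univ| ≤ 2 * δ := by
  classical
  have hvol (w : WeightFunction V) (hw₀ : w.edgeWeight univ ≠ 0) : w.vol X / w.vol univ =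
      (1 + w.edgeWeight X / w.edgeWeight univ - w.edgeWeight Xᶜ / w.edgeWeight univ) / 2 := by
    rw [vol_univ, vol_eq_edgeWeight]
    field_simp
  rw [hvol w (right_ne_zero_of_mul hw.ne'), hvol w' (h.edgeWeight_univ_pos hw hδ).ne']
  have hX := abs_le.1 (h.abs_edgeWeight_div_sub_le hw hδ X)
  have hXc := abs_le.1 (h.abs_edgeWeight_div_sub_le hw hδ Xᶜ)
  exact abs_le.2 ⟨by linarith, by linarith⟩

theorem abs_sq_vol_div_sub_le (h : w'.ApproxScaled q w δ) (hw : 0 < q * w.edgeWeight univ)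
    (hδ : δ < 1) (X : Finset V) :
    |(w'.vol X / w'.vol univ) ^ 2 - (w.vol X / w.vol univ) ^ 2| ≤ 4 * δ := by
  have hsum : |w'.vol X / w'.vol univ + w.vol X / w.vol univ| ≤ 2 := by
    rw [abs_of_nonneg (add_nonneg (w'.vol_div_vol_univ_nonneg X) (w.vol_div_vol_univ_nonneg X))]
    linarith [w'.vol_div_vol_univ_le_one X, w.vol_div_vol_univ_le_one X]
  rw [sq_sub_sq, abs_mul]
  calc _ ≤ 2 * (2 * δ) :=
        mul_le_mul hsum (h.abs_vol_div_sub_le hw hδ X) (abs_nonneg _) zero_le_two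
    _ = 4 * δ := by ring

theorem abs_score_sub_le [DecidableEq V] (h : w'.ApproxScaled q w δ)
    (hw : 0 < q * w.edgeWeight univ) (hδ : δ < 1) (A : Finpartition (univ : Finset V)) :
    |w'.score A - w.score A| ≤ #A.parts * (6 * δ) := by
  rw [score_eq_sum_parts, score_eq_sum_parts, ← Finset.sum_sub_distrib, ← nsmul_eq_mul]
  refine (Finset.abs_sum_le_sum_abs _ _).trans (Finset.sum_le_card_nsmul _ _ _ fun X _ => ?_)
  rw [sub_sub_sub_comm]
  refine (abs_sub _ _).trans ?_
  linarith [h.abs_edgeWeight_div_sub_le hw hδ X, h.abs_sq_vol_div_sub_le hw hδ X]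

end ApproxScaled

end WeightFunction

/-! ### Merging the parts of a partition -/

/-- Next-fit packing of items of sizes `v 0, v 1, …` into bins: the number and the content of the
current bin after `j` items. A bin is closed when its content reaches `θ`. -/
def nextFit (θ : ℝ) (v : ℕ → ℝ) : ℕ → ℕ × ℝ
  | 0 => (0, 0)
  | j + 1 =>
    if θ ≤ (nextFit θ v j).2 + v j then ((nextFit θ v j).1 + 1, 0)
    else ((nextFit θ v j).1, (nextFit θ v j).2 + v j)

namespace nextFit

variable {θ : ℝ} {v : ℕ → ℝ}

theorem fst_succ (j : ℕ) : (nextFit θ v (j + 1)).1 =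
    if θ ≤ (nextFit θ v j).2 + v j then (nextFit θ v j).1 + 1 else (nextFit θ v j).1 := by
  rw [nextFit]
  split_ifs <;> rfl

theorem snd_succ (j : ℕ) : (nextFit θ v (j + 1)).2 =
    if θ ≤ (nextFit θ v j).2 + v j then 0 else (nextFit θ v j).2 + v j := by
  rw [nextFit]
  split_ifs <;> rfl

theorem fst_le (j : ℕ) : (nextFit θ v j).1 ≤ j := by
  induction j with
  | zero => rfl
  | succ j ih => rw [fst_succ]; split_ifs <;> omega

theorem fst_mono : Monotone fun j => (nextFit θ v j).1 :=
  monotone_nat_of_le_succ fun j => by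
    rw [fst_succ]
    split_ifs <;> omega

theorem snd_nonneg (hv : ∀ i, 0 ≤ v i) (j : ℕ) : 0 ≤ (nextFit θ v j).2 := by
  induction j with
  | zero => rfl
  | succ j ih => rw [snd_succ]; split_ifs; exacts [le_rfl, add_nonneg ih (hv j)]

theorem snd_le (hθ : 0 ≤ θ) (j : ℕ) : (nextFit θ v j).2 ≤ θ := by
  cases j with
  | zero => exact hθ
  | succ j => rw [snd_succ]; split_ifs with h; exacts [hθ, (not_le.1 h).le]

theorem fst_mul_add_snd_le (j : ℕ) :
    (nextFit θ v j).1 * θ + (nextFit θ v j).2 ≤ ∑ i ∈ range j, v i := by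
  induction j with
  | zero => simp [nextFit]
  | succ j ih =>
    rw [fst_succ, snd_succ, Finset.sum_range_succ]
    split_ifs with h
    · push_cast
      linarith
    · linarith

theorem snd_eq_sum (j : ℕ) : (nextFit θ v j).2 =
    ∑ i ∈ range j with (nextFit θ v i).1 = (nextFit θ v j).1, v i := by
  simp_rw [Finset.sum_filter]
  induction j with
  | zero => rfl
  | succ j ih =>
    rw [snd_succ, fst_succ]
    split_ifs with h
    · refine (Finset.sum_eq_zero fun i hi => if_neg ?_).symm
      have : (nextFit θ v i).1 ≤ (nextFit θ v j).1 :=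
        fst_mono (Nat.lt_succ_iff.1 (Finset.mem_range.1 hi))
      omega
    · rw [Finset.sum_range_succ, if_pos rfl, ← ih]

end nextFit

namespace WeightFunction

section Merging

variable {V : Type u} [Fintype V] (w : WeightFunction V)

/-- The volume of the class with label `l`. -/
def labelVol (f : V → ℕ) (l : ℕ) : ℝ := w.vol {x | f x = l}

theorem labelVol_nonneg (f : V → ℕ) (l : ℕ) : 0 ≤ w.labelVol f l := w.vol_nonneg _

theorem sum_labelVol (f : V → ℕ) (s : Finset ℕ) :
    ∑ l ∈ s, w.labelVol f l = w.vol {x | f x ∈ s} :=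
  Finset.sum_fiberwise_eq_sum_filter univ s f w.deg

/-- The labelling obtained from `f` by packing the classes, in the order of their labels, into
bins of volume about `η` times the total volume. -/
def mergeLabel (η : ℝ) (f : V → ℕ) (x : V) : ℕ :=
  (nextFit (η * w.vol univ) (w.labelVol f) (f x)).1

theorem mergeLabel_le (η : ℝ) (f : V → ℕ) (x : V) : w.mergeLabel η f x ≤ f x := nextFit.fst_le _

theorem mergeLabel_le_one_div {η : ℝ} (hη : 0 < η) (hw : 0 < w.vol univ) (f : V → ℕ) (x : V) :
    (w.mergeLabel η f x : ℝ) ≤ 1 / η := by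
  have hpacked := calc
    w.mergeLabel η f x * (η * w.vol univ)
      ≤ w.mergeLabel η f x * (η * w.vol univ) +
          (nextFit (η * w.vol univ) (w.labelVol f) (f x)).2 :=
        le_add_of_nonneg_right (nextFit.snd_nonneg (w.labelVol_nonneg f) _)
    _ ≤ ∑ l ∈ range (f x), w.labelVol f l := nextFit.fst_mul_add_snd_le _
    _ = w.vol {y | f y ∈ range (f x)} := w.sum_labelVol f _
    _ ≤ 1 * w.vol univ := by rw [one_mul]; exact w.vol_mono (subset_univ _)
  rw [← mul_assoc] at hpacked
  rw [le_div_iff₀ hη]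
  exact le_of_mul_le_mul_right hpacked hw

theorem sum_deg_merged_below_le {η : ℝ} (hη : 0 ≤ η) (f : V → ℕ) (x : V) :
    ∑ y with f y < f x ∧ w.mergeLabel η f y = w.mergeLabel η f x, w.deg y ≤ η * w.vol univ := by
  set θ := η * w.vol univ
  calc ∑ y with f y < f x ∧ w.mergeLabel η f y = w.mergeLabel η f x, w.deg y
      = ∑ l ∈ range (f x) with
          (nextFit θ (w.labelVol f) l).1 = (nextFit θ (w.labelVol f) (f x)).1, w.labelVol f l := by
        rw [sum_labelVol]
        simp only [mem_filter, mem_range]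
        rfl
    _ = (nextFit θ (w.labelVol f) (f x)).2 := (nextFit.snd_eq_sum _).symm
    _ ≤ θ := nextFit.snd_le (mul_nonneg hη (w.vol_nonneg univ)) _

theorem sum_deg_mul_deg_merged_le {η : ℝ} (hη : 0 ≤ η) (f : V → ℕ) :
    ∑ x, ∑ y with w.mergeLabel η f y = w.mergeLabel η f x ∧ f y ≠ f x, w.deg x * w.deg y ≤
      2 * η * w.vol univ ^ 2 := by
  have hbelow : ∑ x, ∑ y with f y < f x ∧ w.mergeLabel η f y = w.mergeLabel η f x,
      w.deg x * w.deg y ≤ η * w.vol univ ^ 2 :=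
    calc _ ≤ ∑ x, w.deg x * (η * w.vol univ) := by
          simp_rw [← Finset.mul_sum]
          gcongr with x
          · exact w.deg_nonneg x
          · exact w.sum_deg_merged_below_le hη f x
      _ = w.vol univ * (η * w.vol univ) := (Finset.sum_mul _ _ _).symm
      _ = η * w.vol univ ^ 2 := by ring
  have habove : ∑ x, ∑ y with f x < f y ∧ w.mergeLabel η f y = w.mergeLabel η f x,
      w.deg x * w.deg y =
        ∑ x, ∑ y with f y < f x ∧ w.mergeLabel η f y = w.mergeLabel η f x, w.deg x * w.deg y := by
    simp_rw [Finset.sum_filter]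
    rw [Finset.sum_comm]
    simp only [eq_comm, mul_comm]
  have hsplit (x : V) :
      ∑ y with w.mergeLabel η f y = w.mergeLabel η f x ∧ f y ≠ f x, w.deg x * w.deg y =
        ∑ y with f y < f x ∧ w.mergeLabel η f y = w.mergeLabel η f x, w.deg x * w.deg y +
          ∑ y with f x < f y ∧ w.mergeLabel η f y = w.mergeLabel η f x, w.deg x * w.deg y := by
    classical
    rw [← Finset.sum_union (disjoint_filter.2 fun y _ h h' => h.1.not_gt h'.1), ← filter_or]
    simp only [← or_and_right, lt_or_lt_iff_ne, and_comm]
  simp_rw [hsplit, Finset.sum_add_distrib, habove]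
  linarith

variable [DecidableEq V]

/-- The partition whose parts are the unions of the classes of `f` packed into the same bin. -/
def mergedPartition (η : ℝ) (f : V → ℕ) : Finpartition (univ : Finset V) :=
  labelPartition (w.mergeLabel η f)

theorem card_mergedPartition_parts_le {η : ℝ} (hη : 0 < η) (hw : 0 < w.vol univ) (f : V → ℕ) :
    (#(w.mergedPartition η f).parts : ℝ) ≤ 1 / η + 1 := by
  have himage : univ.image (w.mergeLabel η f) ⊆ range (⌊1 / η⌋₊ + 1) := by
    intro l hl
    obtain ⟨x, -, rfl⟩ := mem_image.1 hl
    exact mem_range.2 (Nat.lt_succ_of_le (Nat.le_floor (w.mergeLabel_le_one_div hη hw f x)))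
  calc (#(w.mergedPartition η f).parts : ℝ) ≤ (⌊1 / η⌋₊ + 1 : ℕ) := by
        exact_mod_cast (isLabelling_labelPartition _).card_parts_le.trans
          ((card_le_card himage).trans_eq (card_range _))
    _ ≤ 1 / η + 1 := by
        push_cast
        gcongr
        exact Nat.floor_le (one_div_pos.2 hη).le

theorem score_sub_le_score_mergedPartition {η : ℝ} (hη : 0 ≤ η) {f : V → ℕ}
    {A : Finpartition (univ : Finset V)} (hf : IsLabelling f A) :
    w.score A - 2 * η ≤ w.score (w.mergedPartition η f) := by
  have hg : IsLabelling (w.mergeLabel η f) (w.mergedPartition η f) := isLabelling_labelPartition _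
  have hcoarser (x : V) : A.part x ⊆ (w.mergedPartition η f).part x := by
    rw [hf.part_eq, hg.part_eq]
    exact monotone_filter_right _ fun y _ h => by simp only [mergeLabel, h]
  refine le_trans ?_ (w.score_sub_le_of_part_subset hcoarser)
  gcongr
  simp_rw [hf.part_eq, hg.part_eq, ← filter_and_not]
  exact div_le_of_le_mul₀ (sq_nonneg _) (by positivity) (w.sum_deg_mul_deg_merged_le hη f)

end Merging

section Modularity

variable {V : Type u} [Fintype V] [DecidableEq V] {w w' : WeightFunction V}

theorem score_le_modularity (w : WeightFunction V) (A : Finpartition (univ : Finset V)) :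
    w.score A ≤ w.modularity := Finset.le_sup' w.score (mem_univ A)

theorem modularity_sub_le {η γ : ℝ} (hη : 0 < η) (hw : 0 < w.vol univ)
    (h : ∀ A : Finpartition (univ : Finset V), (#A.parts : ℝ) ≤ 1 / η + 1 →
      w.score A - γ ≤ w'.score A) :
    w.modularity - (2 * η + γ) ≤ w'.modularity := by
  obtain ⟨A, -, hA⟩ := Finset.exists_mem_eq_sup' ⟨⊥, mem_univ _⟩ w.score
  obtain ⟨f, hf⟩ := exists_isLabelling A
  rw [modularity, hA]
  linarith [w.score_sub_le_score_mergedPartition hη.le hf,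
    h _ (w.card_mergedPartition_parts_le hη hw f), w'.score_le_modularity (w.mergedPartition η f)]

theorem abs_modularity_sub_le {η γ : ℝ} (hη : 0 < η) (hw : 0 < w.vol univ) (hw' : 0 < w'.vol univ)
    (h : ∀ A : Finpartition (univ : Finset V), (#A.parts : ℝ) ≤ 1 / η + 1 →
      |w'.score A - w.score A| ≤ γ) :
    |w'.modularity - w.modularity| ≤ 2 * η + γ := by
  have hle := modularity_sub_le hη hw fun A hA => show w.score A - γ ≤ w'.score A by
    linarith [(abs_le.1 (h A hA)).1]
  have hge := modularity_sub_le hη hw' fun A hA => show w'.score A - γ ≤ w.score A by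
    linarith [(abs_le.1 (h A hA)).2]
  exact abs_le.2 ⟨by linarith, by linarith⟩

theorem deficit_mergedPartition_le {η γ : ℝ} (hη : 0 < η) (hw : 0 < w.vol univ)
    (hw' : 0 < w'.vol univ)
    (h : ∀ A : Finpartition (univ : Finset V), (#A.parts : ℝ) ≤ 1 / η + 1 →
      |w'.score A - w.score A| ≤ γ)
    {f : V → ℕ} {A : Finpartition (univ : Finset V)} (hf : IsLabelling f A) :
    w.deficit (w'.mergedPartition η f) ≤ w'.deficit A + (4 * η + 2 * γ) := by
  rw [deficit, deficit]
  linarith [(abs_le.1 (abs_modularity_sub_le hη hw hw' h)).1,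
    (abs_le.1 (h _ (w'.card_mergedPartition_parts_le hη hw' f))).2,
    w'.score_sub_le_score_mergedPartition hη.le hf]

end Modularity

namespace ApproxScaled

variable {V : Type u} [Fintype V] [DecidableEq V] {w w' : WeightFunction V} {q η : ℝ}

theorem abs_score_sub_le_of_card_parts_le (h : w'.ApproxScaled q w (η ^ 2 / (6 * (1 + η) ^ 2)))
    (hη : 0 < η) (hw : 0 < q * w.edgeWeight univ) (A : Finpartition (univ : Finset V))
    (hA : (#A.parts : ℝ) ≤ 1 / η + 1) : |w'.score A - w.score A| ≤ η :=
  calc |w'.score A - w.score A| ≤ #A.parts * (6 * (η ^ 2 / (6 * (1 + η) ^ 2))) :=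
        h.abs_score_sub_le hw (sq_div_six_mul_one_add_sq_lt_one hη.le) A
    _ ≤ (1 / η + 1) * (6 * (η ^ 2 / (6 * (1 + η) ^ 2))) := by gcongr
    _ = η / (1 + η) := by field_simp
    _ ≤ η := div_le_self hη.le (by linarith)

theorem abs_modularity_sub_le (h : w'.ApproxScaled q w (η ^ 2 / (6 * (1 + η) ^ 2)))
    (hη : 0 < η) (hq : 0 < q) (hw : 0 < w.edgeWeight univ) :
    |w'.modularity - w.modularity| ≤ 3 * η := by
  have hqw : 0 < q * w.edgeWeight univ := mul_pos hq hw
  have hw' := h.edgeWeight_univ_pos hqw (sq_div_six_mul_one_add_sq_lt_one hη.le)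
  linarith [WeightFunction.abs_modularity_sub_le hη (w.vol_univ_pos.2 hw) (w'.vol_univ_pos.2 hw')
    (h.abs_score_sub_le_of_card_parts_le hη hqw)]

theorem deficit_mergedPartition_le (h : w'.ApproxScaled q w (η ^ 2 / (6 * (1 + η) ^ 2)))
    (hη : 0 < η) (hq : 0 < q) (hw : 0 < w.edgeWeight univ) {f : V → ℕ}
    {A : Finpartition (univ : Finset V)} (hf : IsLabelling f A) :
    w.deficit (w'.mergedPartition η f) ≤ w'.deficit A + 6 * η := by
  have hqw : 0 < q * w.edgeWeight univ := mul_pos hq hw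
  have hw' := h.edgeWeight_univ_pos hqw (sq_div_six_mul_one_add_sq_lt_one hη.le)
  linarith [WeightFunction.deficit_mergedPartition_le hη (w.vol_univ_pos.2 hw)
    (w'.vol_univ_pos.2 hw') (h.abs_score_sub_le_of_card_parts_le hη hqw) hf]

end ApproxScaled

end WeightFunction

/-! ### The conversion program -/

namespace Program

/-- Timed total correctness: from every memory satisfying `pre`, the program halts after at most
`T` steps in a memory satisfying `post`. -/
def TimedTriple (P : Program) (pre : Store → Prop) (T : ℕ) (post : Store → Prop) : Prop :=
  ∀ s, pre s → ∃ t ≤ T, ∃ s', P.Runs s t s' ∧ post s'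

/-- Straight-line code: the program executing a list of instructions. -/
def block : List Instr → Program
  | [] => skip
  | i :: l => seq (instr i) (block l)

theorem runs_block (l : List Instr) (s : Store) :
    (block l).Runs s (l.length + 1) (l.foldl (fun s i => i.exec s) s) := by
  induction l generalizing s with
  | nil => exact .skip s
  | cons i l ih =>
    have hrun := Runs.seq (.instr i s) (ih (i.exec s))
    rwa [add_comm 1] at hrun

namespace TimedTriple

variable {P Q : Program} {b : Test} {pre mid post : Store → Prop} {T T₁ T₂ : ℕ}

theorem mono (h : P.TimedTriple pre T₁ post) (hT : T₁ ≤ T₂) : P.TimedTriple pre T₂ post :=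
  fun s hs =>
    let ⟨t, ht, s', hrun, hpost⟩ := h s hs
    ⟨t, ht.trans hT, s', hrun, hpost⟩

theorem block (l : List Instr) (h : ∀ s, pre s → post (l.foldl (fun s i => i.exec s) s)) :
    (block l).TimedTriple pre (l.length + 1) post :=
  fun s hs => ⟨_, le_rfl, _, runs_block l s, h s hs⟩

theorem seq (hP : P.TimedTriple pre T₁ mid) (hQ : Q.TimedTriple mid T₂ post) :
    (P.seq Q).TimedTriple pre (T₁ + T₂) post := by
  intro s hs
  obtain ⟨t₁, ht₁, s₁, hrun₁, hmid⟩ := hP s hs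
  obtain ⟨t₂, ht₂, s₂, hrun₂, hpost⟩ := hQ s₁ hmid
  exact ⟨t₁ + t₂, add_le_add ht₁ ht₂, s₂, hrun₁.seq hrun₂, hpost⟩

theorem cond (hP : P.TimedTriple (fun s => pre s ∧ b.Holds s) T post)
    (hQ : Q.TimedTriple (fun s => pre s ∧ ¬ b.Holds s) T post) :
    (cond b P Q).TimedTriple pre (T + 1) post := by
  intro s hs
  by_cases hb : b.Holds s
  · obtain ⟨t, ht, s', hrun, hpost⟩ := hP s ⟨hs, hb⟩
    exact ⟨t + 1, by omega, s', .cond_true hb hrun, hpost⟩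
  · obtain ⟨t, ht, s', hrun, hpost⟩ := hQ s ⟨hs, hb⟩
    exact ⟨t + 1, by omega, s', .cond_false hb hrun, hpost⟩

theorem loop {N : ℕ} {inv : ℕ → Store → Prop}
    (hb : ∀ i ≤ N, ∀ s, inv i s → (b.Holds s ↔ i < N))
    (hP : ∀ i < N, P.TimedTriple (inv i) T (inv (i + 1))) :
    (loop b P).TimedTriple (inv 0) (N * (T + 1) + 1) (inv N) := by
  suffices H : ∀ k i, i + k = N → (Program.loop b P).TimedTriple (inv i) (k * (T + 1) + 1) (inv N)
    from H N 0 (zero_add N)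
  intro k
  induction k with
  | zero =>
    rintro i rfl s hs
    exact ⟨1, by omega, s, .loop_false fun h => lt_irrefl _ ((hb i le_rfl s hs).1 h), hs⟩
  | succ k ih =>
    intro i hi s hs
    obtain ⟨t₁, ht₁, s₁, hrun₁, hinv⟩ := hP i (by omega) s hs
    obtain ⟨t₂, ht₂, s₂, hrun₂, hpost⟩ := ih (i + 1) (by omega) s₁ hinv
    refine ⟨t₁ + t₂ + 1, ?_, s₂, .loop_true ((hb i (by omega) s hs).2 (by omega)) hrun₁ hrun₂,
      hpost⟩
    rw [add_mul]
    omega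

end TimedTriple

/-- Add the weight of the current edge to the volumes of the classes of its two ends, and twice to
the total volume. -/
def addEdge : Program :=
  block [.nload 4 0 3, .nload 4 2 4, .rload 1 0 3, .rload 2 1 4, .radd 2 2 1, .rstore 1 4 2,
    .nload 4 1 3, .nload 4 2 4, .rload 2 1 4, .radd 2 2 1, .rstore 1 4 2,
    .radd 3 3 1, .radd 3 3 1, .nadd 3 3 2]

/-- Compute the volumes of all classes and the total volume. -/
def computeVolumes : Program :=
  .seq (block [.nconst 2 1, .nconst 3 0, .rconst 3 0]) (loop (.nlt 3 1) addEdge)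

/-- Put the current class into the current bin, and open a new bin if the content has reached the
threshold. -/
def packClass : Program :=
  .seq (block [.rload 2 1 3, .radd 6 6 2, .nstore 4 3 5]) <|
  .seq (cond (.rle 5 6) (block [.nadd 5 5 2, .rconst 6 0]) (block [])) <|
    block [.nadd 3 3 2]

/-- Pack the classes into bins by the next-fit rule, with threshold `ε / 8` times the total
volume. -/
def packClasses : Program :=
  .seq (block [.rconst 4 8, .rdiv 5 0 4, .rmul 5 5 3, .nconst 3 0, .nconst 5 0, .rconst 6 0])
    (loop (.nlt 3 0) packClass)

/-- Label the current vertex by the bin of its class. -/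
def relabelVertex : Program :=
  block [.nload 4 2 3, .nload 4 4 4, .nstore 3 3 4, .nadd 3 3 2]

/-- Label every vertex by the bin of its class. -/
def relabelVertices : Program :=
  .seq (block [.nconst 3 0]) (loop (.nlt 3 0) relabelVertex)

/-- The algorithm of the theorem, merging classes of small volume. Beyond the input, it uses the
natural-number registers `2` (the constant `1`), `3` (the loop counter), `4` (an address) and `5`
(the current bin), the real registers `1`, `2`, `4` (temporary values), `3` (the total volume),
`5` (the threshold) and `6` (the content of the current bin), the natural-number array `4` (the
bins of the classes) and the real array `1` (the volumes of the classes). -/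
def convert : Program := .seq computeVolumes (.seq packClasses relabelVertices)

section Invariants

variable (s₀ : Store)

/-- The volume of class `l` in the graph formed by the first `i` edges listed in the memory
`s₀`. -/
def partialVol (i l : ℕ) : ℝ :=
  ∑ j ∈ range i, ((if s₀.narr 2 (s₀.narr 0 j) = l then s₀.rarr 0 j else 0) +
    if s₀.narr 2 (s₀.narr 1 j) = l then s₀.rarr 0 j else 0)

/-- Twice the sum of the edge weights listed in the memory `s₀`, among the first `i` edges. -/
def partialTotal (i : ℕ) : ℝ := ∑ j ∈ range i, (s₀.rarr 0 j + s₀.rarr 0 j)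

/-- The memory after `i` steps of `addEdge`, on the input in the memory `s₀`. -/
structure EdgeInv (i : ℕ) (s : Store) : Prop where
  numVertices : s.nreg 0 = s₀.nreg 0
  numEdges : s.nreg 1 = s₀.nreg 1
  one : s.nreg 2 = 1
  counter : s.nreg 3 = i
  fstEnds : s.narr 0 = s₀.narr 0
  sndEnds : s.narr 1 = s₀.narr 1
  labels : s.narr 2 = s₀.narr 2
  eps : s.rreg 0 = s₀.rreg 0
  total : s.rreg 3 = partialTotal s₀ i
  weights : s.rarr 0 = s₀.rarr 0
  vols : s.rarr 1 = partialVol s₀ i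

theorem addEdge_timedTriple (i : ℕ) :
    addEdge.TimedTriple (EdgeInv s₀ i) 15 (EdgeInv s₀ (i + 1)) := by
  refine .block _ fun s h => ?_
  constructor
  case vols =>
    funext l
    rw [partialVol, Finset.sum_range_succ, ← partialVol]
    simp [Instr.exec, Function.update_apply, h.counter, h.fstEnds, h.sndEnds, h.labels,
      h.weights, h.vols]
    grind
  case total =>
    rw [partialTotal, Finset.sum_range_succ, ← partialTotal]
    simp [Instr.exec, h.counter, h.weights, h.total, add_assoc]
  all_goals
    simp [Instr.exec, h.numVertices, h.numEdges, h.one, h.counter, h.fstEnds, h.sndEnds,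
      h.labels, h.eps, h.weights]

theorem computeVolumes_timedTriple (hvols : s₀.rarr 1 = 0) :
    computeVolumes.TimedTriple (· = s₀) (16 * s₀.nreg 1 + 5) (EdgeInv s₀ (s₀.nreg 1)) := by
  have hstart : (block [.nconst 2 1, .nconst 3 0, .rconst 3 0]).TimedTriple (· = s₀) 4
      (EdgeInv s₀ 0) := by
    refine .block _ fun s h => ?_
    subst h
    constructor
    case vols => funext l; simp [Instr.exec, hvols, partialVol]
    all_goals simp [Instr.exec, partialTotal]
  exact (hstart.seq <| .loop (fun i _ s h => by simp [Test.Holds, h.numEdges, h.counter])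
    fun i _ => addEdge_timedTriple s₀ i).mono (by omega)

variable (θ : ℝ) (v : ℕ → ℝ)

/-- The memory while classes of volumes `v` are packed with threshold `θ`: the bins of the first
`k` classes are recorded, class `j` is current, and the current bin and its content are `q`. -/
structure PackInv (k j : ℕ) (q : ℕ × ℝ) (s : Store) : Prop where
  numVertices : s.nreg 0 = s₀.nreg 0
  one : s.nreg 2 = 1
  counter : s.nreg 3 = j
  bin : s.nreg 5 = q.1
  labels : s.narr 2 = s₀.narr 2
  bins : ∀ i < k, s.narr 4 i = (nextFit θ v i).1
  threshold : s.rreg 5 = θ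
  content : s.rreg 6 = q.2
  vols : s.rarr 1 = v

variable {θ v}

theorem putClass_timedTriple (j : ℕ) :
    (block [.rload 2 1 3, .radd 6 6 2, .nstore 4 3 5]).TimedTriple
      (PackInv s₀ θ v j j (nextFit θ v j)) 4
      (PackInv s₀ θ v (j + 1) j ((nextFit θ v j).1, (nextFit θ v j).2 + v j)) := by
  refine .block _ fun s h => ?_
  constructor
  case bins =>
    intro i hi
    rcases Nat.lt_succ_iff_lt_or_eq.1 hi with hi | rfl
    · simp [Instr.exec, h.counter, hi.ne, h.bins i hi]
    · simp [Instr.exec, h.counter, h.bin]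
  all_goals
    simp [Instr.exec, h.numVertices, h.one, h.counter, h.bin, h.labels, h.threshold, h.content,
      h.vols]

theorem openBin_timedTriple (k j : ℕ) :
    (cond (.rle 5 6) (block [.nadd 5 5 2, .rconst 6 0]) (block [])).TimedTriple
      (PackInv s₀ θ v k j ((nextFit θ v j).1, (nextFit θ v j).2 + v j)) 4
      (PackInv s₀ θ v k j (nextFit θ v (j + 1))) := by
  refine .cond (T := 3) (.block _ fun s ⟨h, hfull⟩ => ?_)
    (.mono (T₁ := 1) (.block _ fun s ⟨h, hfull⟩ => ?_) (by norm_num))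
  all_goals simp only [Test.Holds, h.threshold, h.content] at hfull
  · constructor
    case bins => exact h.bins
    all_goals
      simp [Instr.exec, nextFit, hfull, h.numVertices, h.one, h.counter, h.bin, h.labels,
        h.threshold, h.vols]
  · rw [nextFit, if_neg hfull]
    exact h

theorem packClass_timedTriple (j : ℕ) :
    packClass.TimedTriple (PackInv s₀ θ v j j (nextFit θ v j)) 10
      (PackInv s₀ θ v (j + 1) (j + 1) (nextFit θ v (j + 1))) := by
  refine .seq (putClass_timedTriple s₀ j) <| .seq (openBin_timedTriple s₀ (j + 1) j) <|
    .block _ fun s h => ?_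
  constructor
  case bins => exact h.bins
  all_goals
    simp [Instr.exec, h.numVertices, h.one, h.counter, h.bin, h.labels, h.threshold, h.content,
      h.vols]

theorem packClasses_timedTriple {i : ℕ} (hθ : θ = s₀.rreg 0 / 8 * partialTotal s₀ i)
    (hv : v = partialVol s₀ i) :
    packClasses.TimedTriple (EdgeInv s₀ i) (11 * s₀.nreg 0 + 8)
      (PackInv s₀ θ v (s₀.nreg 0) (s₀.nreg 0) (nextFit θ v (s₀.nreg 0))) := by
  have hstart : (block [.rconst 4 8, .rdiv 5 0 4, .rmul 5 5 3, .nconst 3 0, .nconst 5 0,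
      .rconst 6 0]).TimedTriple (EdgeInv s₀ i) 7 (PackInv s₀ θ v 0 0 (nextFit θ v 0)) := by
    refine .block _ fun s h => ?_
    constructor
    case bins => simp
    all_goals
      simp [Instr.exec, nextFit, h.numVertices, h.one, h.labels, h.eps, h.total, h.vols, hθ, hv]
  exact (hstart.seq <| .loop (inv := fun j => PackInv s₀ θ v j j (nextFit θ v j))
    (fun j _ s h => by simp [Test.Holds, h.numVertices, h.counter])
    fun j _ => packClass_timedTriple s₀ j).mono (by omega)

/-- The memory after `i` steps of `relabelVertex`, if the class labelled `l` is in bin `g l`. -/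
structure RelabelInv (g : ℕ → ℕ) (i : ℕ) (s : Store) : Prop where
  numVertices : s.nreg 0 = s₀.nreg 0
  one : s.nreg 2 = 1
  counter : s.nreg 3 = i
  labels : s.narr 2 = s₀.narr 2
  bins : ∀ l < s₀.nreg 0, s.narr 4 l = g l
  newLabels : ∀ k < i, s.narr 3 k = g (s₀.narr 2 k)

variable {s₀}

theorem relabelVertex_timedTriple (g : ℕ → ℕ) {i : ℕ} (hi : s₀.narr 2 i < s₀.nreg 0) :
    relabelVertex.TimedTriple (RelabelInv s₀ g i) 5 (RelabelInv s₀ g (i + 1)) := by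
  refine .block _ fun s h => ?_
  constructor
  case newLabels =>
    intro k hk
    rcases Nat.lt_succ_iff_lt_or_eq.1 hk with hk | rfl
    · simp [Instr.exec, h.counter, hk.ne, h.newLabels k hk]
    · simp [Instr.exec, h.counter, h.labels, h.bins _ hi]
  case bins => exact h.bins
  all_goals simp [Instr.exec, h.numVertices, h.one, h.counter, h.labels]

theorem relabelVertices_timedTriple {j : ℕ} {q : ℕ × ℝ}
    (hlabel : ∀ k < s₀.nreg 0, s₀.narr 2 k < s₀.nreg 0) :
    relabelVertices.TimedTriple (PackInv s₀ θ v (s₀.nreg 0) j q) (6 * s₀.nreg 0 + 3)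
      (RelabelInv s₀ (fun l => (nextFit θ v l).1) (s₀.nreg 0)) := by
  have hstart : (block [.nconst 3 0]).TimedTriple (PackInv s₀ θ v (s₀.nreg 0) j q) 2
      (RelabelInv s₀ (fun l => (nextFit θ v l).1) 0) := by
    refine .block _ fun s h => ?_
    constructor
    case bins => exact h.bins
    all_goals simp [Instr.exec, h.numVertices, h.one, h.labels]
  exact (hstart.seq <| .loop (fun i _ s h => by simp [Test.Holds, h.numVertices, h.counter])
    fun i hi => relabelVertex_timedTriple _ (hlabel i hi)).mono (by omega)

theorem convert_timedTriple (hvols : s₀.rarr 1 = 0)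
    (hlabel : ∀ k < s₀.nreg 0, s₀.narr 2 k < s₀.nreg 0) :
    convert.TimedTriple (· = s₀) (16 * s₀.nreg 1 + 17 * s₀.nreg 0 + 16) fun s =>
      ∀ k < s₀.nreg 0, s.narr 3 k = (nextFit (s₀.rreg 0 / 8 * partialTotal s₀ (s₀.nreg 1))
        (partialVol s₀ (s₀.nreg 1)) (s₀.narr 2 k)).1 := by
  intro s hs
  obtain ⟨t, ht, s', hrun, h⟩ := (computeVolumes_timedTriple s₀ hvols).seq
    ((packClasses_timedTriple s₀ rfl rfl).seq (relabelVertices_timedTriple hlabel)) s hs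
  exact ⟨t, by omega, s', hrun, h.newLabels⟩

end Invariants

end Program

/-! ### The program on encoded instances -/

namespace Encoding

variable {V : Type u} [Fintype V] [DecidableEq V] {w : WeightFunction V}
  {A : Finpartition (univ : Finset V)}

/-- The label of a vertex as a natural number. -/
def natLabel (E : Encoding w A) (x : V) : ℕ := E.label x

theorem isLabelling_natLabel (E : Encoding w A) : IsLabelling E.natLabel A :=
  fun x y => Fin.val_inj.trans (E.describes x y)

theorem sum_sum_eq_sum_edges (E : Encoding w A) {F : V → V → ℝ}
    (hF : ∀ x y, w.weight x y = 0 → F x y = 0) :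
    ∑ x, ∑ y, F x y = (E.edges.map fun q => F q.1 q.2 + F q.2 q.1).sum := by
  have hnonedge (e : Sym2 V) (he : e ∉ (E.edges.map fun q => s(q.1, q.2)).toFinset) :
      Sym2.lift ⟨fun x y => F x y + F y x, fun _ _ => add_comm _ _⟩ e = 0 := by
    induction e with | _ x y
    rw [List.mem_toFinset, E.mem_edges, SimpleGraph.mem_edgeSet] at he
    have hxy : w.weight x y = 0 := le_antisymm (not_lt.1 he) (w.nonneg x y)
    change F x y + F y x = 0
    rw [hF x y hxy, hF y x (w.symm x y ▸ hxy), add_zero]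
  rw [sum_sum_eq_sum_sym2 univ F fun x => hF x x (w.diag x), Finset.sym2_univ,
    ← Finset.sum_subset (subset_univ _) fun e _ he => hnonedge e he,
    List.sum_toFinset _ E.edges_nodup, List.map_map]
  rfl

variable (E : Encoding w A) (ε : ℝ)

theorem store_label (x : V) : (E.store ε).narr 2 (E.enum x) = E.natLabel x := by
  simp [store, natLabel]

theorem sum_store_edges (H : ℕ → ℕ → ℝ → ℝ) :
    ∑ j ∈ range E.edges.length,
      H ((E.store ε).narr 0 j) ((E.store ε).narr 1 j) ((E.store ε).rarr 0 j) =
        (E.edges.map fun q => H (E.enum q.1) (E.enum q.2) (w.weight q.1 q.2)).sum := by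
  rw [Finset.sum_range, ← Fin.sum_univ_fun_getElem]
  exact Finset.sum_congr rfl fun j _ => by simp [store]

theorem partialTotal_store :
    Program.partialTotal (E.store ε) E.edges.length = w.vol univ := by
  rw [Program.partialTotal, E.sum_store_edges ε fun _ _ z => z + z, WeightFunction.vol]
  simp only [WeightFunction.deg]
  rw [E.sum_sum_eq_sum_edges fun _ _ h => h]
  simp only [w.symm]

theorem partialVol_store :
    Program.partialVol (E.store ε) E.edges.length = w.labelVol E.natLabel := by
  funext l
  have hvol : w.labelVol E.natLabel l =
      ∑ x, ∑ y, if E.natLabel x = l then w.weight x y else 0 := by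
    rw [WeightFunction.labelVol, WeightFunction.vol, Finset.sum_filter]
    simp only [WeightFunction.deg, Finset.sum_ite_irrel, Finset.sum_const_zero]
  rw [hvol, E.sum_sum_eq_sum_edges fun x y h => by rw [h, ite_self], Program.partialVol,
    E.sum_store_edges ε fun i j z =>
      (if (E.store ε).narr 2 i = l then z else 0) + if (E.store ε).narr 2 j = l then z else 0]
  simp only [store_label, w.symm]

theorem convert_outputs [Nonempty V] :
    Program.convert.Outputs E ε (40 * E.size) (w.mergedPartition (ε / 8) E.natLabel) := by
  have hlabel (k : ℕ) (hk : k < Fintype.card V) : (E.store ε).narr 2 k < Fintype.card V := by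
    simp [store, hk]
  obtain ⟨t, ht, s, hrun, hs⟩ := Program.convert_timedTriple (s₀ := E.store ε) rfl hlabel _ rfl
  change t ≤ 16 * E.edges.length + 17 * Fintype.card V + 16 at ht
  change ∀ k < Fintype.card V, s.narr 3 k = (nextFit (ε / 8 * Program.partialTotal (E.store ε)
    E.edges.length) (Program.partialVol (E.store ε) E.edges.length) _).1 at hs
  rw [E.partialTotal_store, E.partialVol_store] at hs
  have hcard : 0 < Fintype.card V := Fintype.card_pos
  refine ⟨t, s, fun x => ⟨w.mergeLabel (ε / 8) E.natLabel x,
    (w.mergeLabel_le _ _ x).trans_lt (E.label x).2⟩, hrun, ?_, fun x => ?_, fun x y => ?_⟩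
  · rw [size]
    omega
  · rw [hs _ (E.enum x).2, E.store_label]
    rfl
  · rw [Fin.mk.injEq]
    exact isLabelling_labelPartition (w.mergeLabel (ε / 8) E.natLabel) x y

end Encoding

end

theorem theorem6p2 :
    ∃ (P : Program) (K : ℕ),
      -- on every input, the program converts the partition in a linear number of steps
      (∀ (V : Type u) [Fintype V] [DecidableEq V] [Nonempty V] (w : WeightFunction V)
        (A : Finpartition (univ : Finset V)) (E : Encoding w A) (ε : ℝ), 0 < ε →
          ∃ A' : Finpartition (univ : Finset V), P.Outputs E ε (K * E.size) A') ∧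
      ∀ b ε : ℝ, 0 < b → 0 < ε → ∃ c : ℝ, 0 < c ∧
        ∀ (V : Type u) [Fintype V] [DecidableEq V] [Nonempty V] (w : WeightFunction V) (p : I),
          0 < p → w.Bounded b → c * (Fintype.card V : ℝ) ≤ w.edgeWeight univ * (p : ℝ) →
          1 - ε ≤ (w.edgeLaw p).real
            {S | |(w.keep S).modularity - w.modularity| < ε ∧
              ∀ (A : Finpartition (univ : Finset V)) (E : Encoding (w.keep S) A),
                ∃ A' : Finpartition (univ : Finset V),
                  P.Outputs E ε (K * E.size) A' ∧
                  w.deficit A' < (w.keep S).deficit A + ε} := by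
  refine ⟨Program.convert, 40, fun V _ _ _ w A E ε _ => ⟨_, E.convert_outputs ε⟩,
    fun b ε hb hε => ?_⟩
  set η := ε / 8 with hη
  set δ := η ^ 2 / (6 * (1 + η) ^ 2)
  have hη₀ : 0 < η := by positivity
  have hδ₀ : 0 < δ := by positivity
  have hδ : δ ≤ 2 := by
    linarith [sq_div_six_mul_one_add_sq_lt_one hη₀.le]
  refine ⟨4 * b / δ ^ 2 * (2 + 1 / ε), by positivity, fun V _ _ _ w p hp hw hc => ?_⟩
  have hw₀ : 0 < w.edgeWeight univ :=
    pos_of_mul_pos_left (lt_of_lt_of_le (by positivity) hc) p.2.1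
  calc 1 - ε ≤ (w.edgeLaw p).real {S | (w.keep S).ApproxScaled p w δ} :=
        WeightFunction.one_sub_le_edgeLaw_real_approxScaled hw p hb hδ₀ hδ hε hc
    _ ≤ _ := MeasureTheory.measureReal_mono fun S hS => ?_
  refine ⟨(hS.abs_modularity_sub_le hη₀ hp hw₀).trans_lt (by linarith), fun A E =>
    ⟨_, E.convert_outputs ε, ?_⟩⟩
  linarith [hS.deficit_mergedPartition_le hη₀ hp hw₀ E.isLabelling_natLabel]
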